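/- Let $G$ be a finite connected simple graph with a perfect matching. Let $G[K_4]$ be the composition (lexicographic product) of $G$ with the complete graph $K_4$: its vertex set is $V(G)\times V(K_4)$, and $(v_1,u_1)$ and $(v_2,u_2)$ are adjacent if and only if either $v_1v_2\in E(G)$, or $v_1=v_2$ and $u_1\neq u_2$. Then $G[K_4]$ has an orientable quadrangular embedding, that is, a cellular embedding in an orientable compact surface without boundary in which every face is bounded by a $4$-cycle. Here cellular embeddings of a graph in oriented surfaces are described, as usual, by rotation systems: a cyclic order, at each vertex, of the darts (directed edges) leaving it. The faces are traced by the rule that, after the dart from $u$ to $v$, the boundary walk continues with the dart that follows the dart from $v$ to $u$ in the cyclic order at $v$. -/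

import Mathlib

namespace SimpleGraph

/-- The composition (lexicographic product) `G[H]`: the vertex set is `V(G) × V(H)`, and
`(v₁, u₁)`, `(v₂, u₂)` are adjacent iff `v₁ v₂ ∈ E(G)`, or `v₁ = v₂` and `u₁ u₂ ∈ E(H)`. -/
def composition {V W : Type*} (G : SimpleGraph V) (H : SimpleGraph W) :
    SimpleGraph (V × W) where
  Adj p q := G.Adj p.1 q.1 ∨ (p.1 = q.1 ∧ H.Adj p.2 q.2)
  symm := ⟨by
    rintro p q (h | ⟨h, h'⟩)
    · exact Or.inl h.symm
    · exact Or.inr ⟨h.symm, h'.symm⟩⟩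
  loopless := ⟨by
    rintro p (h | ⟨-, h⟩)
    · exact G.irrefl h
    · exact H.irrefl h⟩

/-- Reversal of darts (edges with a direction), as a permutation. -/
def dartReversal {V : Type*} (G : SimpleGraph V) : Equiv.Perm G.Dart :=
  Function.Involutive.toPerm Dart.symm Dart.symm_involutive

/-- A cellular embedding of a (finite) simple graph `G` in an oriented closed surface, given
combinatorially by its rotation system: at every vertex, a cyclic order of the darts that leave
this vertex.  The cyclic orders are packed into one permutation `rot` of the darts, whose orbits
are exactly the sets of darts with a common origin.  (If `G` is disconnected, so is the surface,
with one component for each component of `G`.) -/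
structure RotationSystem {V : Type*} (G : SimpleGraph V) where
  /-- the next dart in the rotation at the origin of a given dart -/
  rot : Equiv.Perm G.Dart
  /-- the rotation keeps the origin of a dart -/
  fst_rot : ∀ d : G.Dart, (rot d).fst = d.fst
  /-- the rotation at each vertex is one single cycle -/
  sameCycle_of_fst_eq : ∀ d e : G.Dart, d.fst = e.fst → rot.SameCycle d e

namespace RotationSystem

variable {V : Type*} {G : SimpleGraph V}

/-- Face tracing: after traversing a dart `d`, the boundary walk of the face continues with the
dart that follows the reverse of `d` in the rotation at the head of `d`.  The faces of the
embedding are the orbits of this permutation. -/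
def facePerm (R : G.RotationSystem) : Equiv.Perm G.Dart :=
  R.rot * G.dartReversal

/-- The successive darts of the boundary walk, traversed once from `d` on, of the face to which
the dart `d` belongs. -/
noncomputable def faceBoundary (R : G.RotationSystem) (d : G.Dart) : List G.Dart :=
  (List.range (Function.minimalPeriod R.facePerm d)).map fun i => R.facePerm^[i] d

/-- The embedding is quadrangular: every face is bounded by a `4`-cycle of the graph.
The first clause concerns the components of the surface that carry an isolated vertex of `G`
and no edge: their only face is not bounded by a `4`-cycle. -/
def IsQuadrangular (R : G.RotationSystem) : Prop :=
  (∀ v : V, ∃ w : V, G.Adj v w) ∧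
    ∀ d : G.Dart, ∃ C : G.Walk d.fst d.fst,
      C.IsCycle ∧ C.length = 4 ∧ C.darts = R.faceBoundary d

end RotationSystem

/-- `G` has a quadrangular embedding in an orientable closed surface. -/
def HasOrientableQuadrangularEmbedding {V : Type*} (G : SimpleGraph V) : Prop :=
  ∃ R : G.RotationSystem, R.IsQuadrangular

end SimpleGraph

/-!
A perfect matching `μ` splits the edges of `G[K₄]` into blocks: a `K₈` on the two fibres over each
edge of `μ`, and a `K₄,₄` between the fibres over each other edge of `G`.  Every block has a
quadrangular rotation, and the blocks are spliced into one rotation system.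

In the rotation of a block at the vertex `(v, i)`, one neighbour `(w, entry i)` in the other fibre
is marked; the rotation is cut open before it.  The rotation at `(v, i)` runs through the opened
blocks one after the other, in a fixed cyclic order of the neighbours `w` of `v` if `i` is even and
in the opposite order if `i` is odd.  Cutting and regluing replaces the face permutation `φ` of the
disjoint blocks by `γ ∘ φ`, where `γ` permutes the marked darts at every vertex.  The block
embeddings are chosen such that a marked dart at `(v, i)` and the one at `(v, partner i)` to the
same block lie opposite each other on a face that has no other marked dart; `i` and `partner i`
have different parity.  Hence the opposite halves of such faces are exchanged consistently between
consecutive blocks, and all face orbits still have length four: `iterate_four_comp`,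
`faceStep_splice`.

An orbit of length four of the face permutation is automatically a `4`-cycle of a simple graph
without vertices of degree one: the corners two steps apart are distinct, since the rotation fixes
no dart (`RotationSystem.isQuadrangular_of_iterate_four`).

The embedding of `K₈` (`octRotation`) is symmetric under the exchange of the two fibres, so no
orientation of the matching edges has to be chosen; its properties are checked by computation.
-/

namespace SimpleGraph

/-! ### Rotation systems from local rotations -/

section Criterion

variable {W : Type*}

/-- Face tracing on ordered pairs of vertices, for a family `ν` of local rotations: `ν q` sends a
neighbour of `q` to the next one in the rotation at `q`. -/
def faceStep (ν : W → W → W) (x : W × W) : W × W := (x.2, ν x.2 x.1)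

variable {H : SimpleGraph W} {ν : W → W → W}

/-- Face tracing on the darts of `H`, for local rotations that preserve adjacency. -/
def dartFaceStep (hadj : ∀ p q, H.Adj p q → H.Adj p (ν p q)) (d : H.Dart) : H.Dart :=
  ⟨faceStep ν d.toProd, hadj _ _ d.adj.symm⟩

lemma toProd_iterate_dartFaceStep (hadj : ∀ p q, H.Adj p q → H.Adj p (ν p q)) (n : ℕ)
    (d : H.Dart) : ((dartFaceStep hadj)^[n] d).toProd = (faceStep ν)^[n] d.toProd := by
  induction n generalizing d with
  | zero => rfl
  | succ n ih => rw [Function.iterate_succ_apply, ih]; rfl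

/-- If face tracing has order four, it is a permutation, whose inverse is its cube. -/
def dartFaceEquiv (hadj : ∀ p q, H.Adj p q → H.Adj p (ν p q))
    (hfour : ∀ x, (faceStep ν)^[4] x = x) : Equiv.Perm H.Dart where
  toFun := dartFaceStep hadj
  invFun := (dartFaceStep hadj)^[3]
  left_inv d := Dart.ext _ _ <| (toProd_iterate_dartFaceStep hadj 4 d).trans (hfour _)
  right_inv d := Dart.ext _ _ <| (toProd_iterate_dartFaceStep hadj 4 d).trans (hfour _)

/-- The rotation system with given local rotations. -/
def RotationSystem.ofLocal (hadj : ∀ p q, H.Adj p q → H.Adj p (ν p q))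
    (hfour : ∀ x, (faceStep ν)^[4] x = x)
    (hcyc : ∀ p, ∃ e, ∀ q, H.Adj p q → ∃ k, (ν p)^[k] q = e) : H.RotationSystem where
  rot := dartFaceEquiv hadj hfour * H.dartReversal
  fst_rot _ := rfl
  sameCycle_of_fst_eq := by
    have key : ∀ (n : ℕ) (d : H.Dart),
        (((dartFaceEquiv hadj hfour * H.dartReversal) ^ n) d).toProd =
          (d.fst, (ν d.fst)^[n] d.snd) := by
      intro n
      induction n with
      | zero => intro d; rfl
      | succ n ih => intro d; rw [pow_succ, Equiv.Perm.mul_apply, ih]; rfl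
    intro d d' h
    obtain ⟨e, he⟩ := hcyc d.fst
    obtain ⟨k, hk⟩ := he _ d.adj
    obtain ⟨k', hk'⟩ := he d'.snd (h ▸ d'.adj)
    have h' : ((dartFaceEquiv hadj hfour * H.dartReversal) ^ k) d =
        ((dartFaceEquiv hadj hfour * H.dartReversal) ^ k') d' := by
      apply Dart.ext
      rw [key, key, ← h, hk, hk']
    rw [← Equiv.Perm.sameCycle_pow_left (n := k), h', Equiv.Perm.sameCycle_pow_left]

lemma RotationSystem.facePerm_ofLocal (hadj : ∀ p q, H.Adj p q → H.Adj p (ν p q))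
    (hfour : ∀ x, (faceStep ν)^[4] x = x)
    (hcyc : ∀ p, ∃ e, ∀ q, H.Adj p q → ∃ k, (ν p)^[k] q = e) :
    (RotationSystem.ofLocal hadj hfour hcyc).facePerm = dartFaceEquiv hadj hfour := by
  ext1 d
  exact congrArg (dartFaceEquiv hadj hfour) d.symm_symm

/-- In a rotation at a vertex with two neighbours nothing is fixed, because the rotation is a
single cycle. -/
lemma RotationSystem.rot_ne_self (R : H.RotationSystem)
    (hdeg : ∀ p q, H.Adj p q → ∃ r, H.Adj p r ∧ r ≠ q) (d : H.Dart) : R.rot d ≠ d := by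
  intro h
  obtain ⟨r, hr, hne⟩ := hdeg _ _ d.adj
  obtain ⟨n, hn⟩ := R.sameCycle_of_fst_eq d ⟨(d.fst, r), hr⟩ rfl
  rw [Equiv.Perm.zpow_apply_eq_self_of_apply_eq_self h] at hn
  exact hne (congrArg (fun e : H.Dart => e.snd) hn).symm

/-- If no vertex has degree one, a face permutation of order four forces all faces to be bounded
by `4`-cycles: opposite corners of a face are distinct as the rotation has no fixed dart. -/
lemma RotationSystem.isQuadrangular_of_iterate_four (R : H.RotationSystem)
    (hne : ∀ p, ∃ q, H.Adj p q)
    (hdeg : ∀ p q, H.Adj p q → ∃ r, H.Adj p r ∧ r ≠ q)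
    (hfour : ∀ d, R.facePerm^[4] d = d) : R.IsQuadrangular := by
  refine ⟨hne, fun d => ?_⟩
  have hfst : ∀ d : H.Dart, (R.facePerm d).fst = d.snd := fun d => R.fst_rot _
  have hsnd : ∀ d : H.Dart, (R.facePerm d).snd ≠ d.fst := by
    intro d h
    exact R.rot_ne_self hdeg d.symm (Dart.ext _ _ (Prod.ext (R.fst_rot _) h))
  obtain ⟨d₁, h₁⟩ : ∃ e, e = R.facePerm d := ⟨_, rfl⟩
  obtain ⟨d₂, h₂⟩ : ∃ e, e = R.facePerm d₁ := ⟨_, rfl⟩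
  obtain ⟨d₃, h₃⟩ : ∃ e, e = R.facePerm d₂ := ⟨_, rfl⟩
  have h₀ : d = R.facePerm d₃ := by rw [h₃, h₂, h₁]; exact (hfour d).symm
  have e₁ : d₁.fst = d.snd := by rw [h₁, hfst]
  have e₂ : d₂.fst = d₁.snd := by rw [h₂, hfst]
  have e₃ : d₃.fst = d₂.snd := by rw [h₃, hfst]
  have e₀ : d.fst = d₃.snd := by
    conv_lhs => rw [h₀, hfst]
  have n₁ : d₁.snd ≠ d.fst := by rw [h₁]; exact hsnd d
  have n₂ : d₂.snd ≠ d₁.fst := by rw [h₂]; exact hsnd d₁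
  have hper : Function.minimalPeriod R.facePerm d = 4 := by
    refine Function.minimalPeriod_eq_prime_pow (p := 2) (k := 1) ?_ (hfour d)
    intro h
    have h' : R.facePerm (R.facePerm d) = d := h
    rw [← h₁, ← h₂] at h'
    exact n₁ (by rw [← e₂, h'])
  have hb : R.faceBoundary d = [d, d₁, d₂, d₃] := by
    simp [RotationSystem.faceBoundary, hper, List.range_succ, h₁, h₂, h₃]
  rw [hb]
  clear hb hper h₀ h₁ h₂ h₃
  obtain ⟨⟨a, b⟩, hab⟩ := d
  obtain ⟨⟨b', c⟩, hbc⟩ := d₁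
  obtain ⟨⟨c', x⟩, hcx⟩ := d₂
  obtain ⟨⟨x', a'⟩, hxa⟩ := d₃
  dsimp only at e₀ e₁ e₂ e₃ n₁ n₂ hab hbc hcx hxa ⊢
  subst e₁ e₂ e₃ e₀
  refine ⟨.cons hab (.cons hbc (.cons hcx (.cons hxa .nil))), ?_, rfl, rfl⟩
  have := hab.ne; have := hbc.ne; have := hcx.ne; have := hxa.ne
  simp [Walk.isCycle_def, Walk.isTrail_def]
  grind

/-- Local rotations whose face tracing has order four give a quadrangular embedding.  That the
rotation at `p` is a single cycle is expressed by a common target `e` of all its orbits. -/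
theorem hasOrientableQuadrangularEmbedding_of_local
    (hadj : ∀ p q, H.Adj p q → H.Adj p (ν p q))
    (hfour : ∀ x, (faceStep ν)^[4] x = x)
    (hcyc : ∀ p, ∃ e, ∀ q, H.Adj p q → ∃ k, (ν p)^[k] q = e)
    (hne : ∀ p, ∃ q, H.Adj p q)
    (hdeg : ∀ p q, H.Adj p q → ∃ r, H.Adj p r ∧ r ≠ q) :
    H.HasOrientableQuadrangularEmbedding := by
  refine ⟨.ofLocal hadj hfour hcyc, RotationSystem.isQuadrangular_of_iterate_four _ hne hdeg ?_⟩
  intro d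
  rw [RotationSystem.facePerm_ofLocal]
  exact (dartFaceEquiv hadj hfour).left_inv d

end Criterion

/-! ### Splicing permutations of order four -/

section Splice

variable {α : Type*} {φ γ : α → α} {S : Set α}

/-- Splicing quadrangular faces.  Let all orbits of `φ` have length dividing four, let those that
meet `S` do so in opposite elements, and let `γ` permute `S` so that two consecutive opposite
corners are glued crosswise.  Then the orbits of `γ ∘ φ` still have length dividing four. -/
lemma iterate_four_comp (hφ : ∀ x, φ^[4] x = x) (hinj : Function.Injective γ)
    (hfix : ∀ x, x ∉ S → γ x = x) (hγS : ∀ x ∈ S, γ x ∈ S)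
    (h₁ : ∀ x ∈ S, φ x ∉ S) (h₂ : ∀ x ∈ S, φ (φ x) ∈ S)
    (h₃ : ∀ x ∈ S, γ (φ (φ (γ (φ (φ x))))) = x) (x : α) : (γ ∘ φ)^[4] x = x := by
  have hφinj : Function.Injective φ := fun a b h => by
    rw [← hφ a, ← hφ b]; exact congrArg φ^[3] h
  have hS : ∀ x ∈ S, (γ ∘ φ)^[4] x = x := by
    intro x hx
    have e : ∀ y ∈ S, (γ ∘ φ) ((γ ∘ φ) y) = γ (φ (φ y)) := by
      intro y hy
      simp only [Function.comp_apply]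
      rw [hfix _ (h₁ y hy)]
    change (γ ∘ φ) ((γ ∘ φ) ((γ ∘ φ) ((γ ∘ φ) x))) = x
    rw [e x hx, e _ (hγS _ (h₂ x hx)), h₃ x hx]
  by_cases hx : x ∈ S
  · exact hS x hx
  by_cases hx₁ : φ x ∈ S
  · apply (hinj.comp hφinj)
    rw [← Function.iterate_succ_apply' (γ ∘ φ), Function.iterate_succ_apply]
    exact hS _ (hγS _ hx₁)
  have h4 : φ (φ (φ (φ x))) = x := hφ x
  have hx₂ : φ (φ x) ∉ S := fun h => hx (h4 ▸ h₂ _ h)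
  have hx₃ : φ (φ (φ x)) ∉ S := fun h => hx₁ (by simpa only [h4] using h₂ _ h)
  change γ (φ (γ (φ (γ (φ (γ (φ x))))))) = x
  rw [hfix _ hx₁, hfix _ hx₂, hfix _ hx₃, h4, hfix _ hx]

/-- Up to its first visit to `S`, an orbit of `γ ∘ β` is an orbit of `β`. -/
lemma exists_iterate_comp_eq {β : α → α} (hfix : ∀ x, x ∉ S → γ x = x) (k : ℕ) (x : α)
    (h : β^[k + 1] x ∈ S) :
    ∃ n, β^[n + 1] x ∈ S ∧ (γ ∘ β)^[n + 1] x = γ (β^[n + 1] x) := by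
  induction k generalizing x with
  | zero => exact ⟨0, h, rfl⟩
  | succ k ih =>
    by_cases hx : β x ∈ S
    · exact ⟨0, hx, rfl⟩
    · obtain ⟨n, hn, hn'⟩ := ih (β x) h
      refine ⟨n + 1, hn, ?_⟩
      rw [Function.iterate_succ_apply, Function.comp_apply, hfix _ hx, hn']
      rfl

end Splice

/-! ### Embeddings of the complete graph on eight vertices and of `K₄,₄` -/

section Tables

/-- The rotations of a quadrangular embedding of `K₈`, whose vertices are split into two fibres of
four.  The entry for `i` is the cyclic order at the vertex `i` of either fibre; a neighbour `j` is
written `(true, j)` if it lies in the other fibre and `(false, j)` if it lies in the same one.  So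
the exchange of the fibres is a symmetry of the embedding. -/
def octRotation : Fin 4 → List (Bool × Fin 4) :=
  ![[(true, 0), (true, 1), (false, 1), (false, 2), (false, 3), (true, 2), (true, 3)],
    [(true, 0), (true, 3), (false, 3), (false, 2), (true, 2), (true, 1), (false, 0)],
    [(true, 0), (true, 2), (false, 3), (false, 1), (false, 0), (true, 1), (true, 3)],
    [(true, 0), (true, 3), (true, 2), (false, 2), (false, 0), (false, 1), (true, 1)]]

/-- The successor in the rotation of `K₈` at a vertex `i`. -/
def octNext (i : Fin 4) (x : Bool × Fin 4) : Bool × Fin 4 := (octRotation i).formPerm x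

/-- The successor in the rotation of `K₄,₄` at a vertex `i`: the four neighbours in increasing
order if `i` is even, in decreasing order if `i` is odd. -/
def quadNext (i j : Fin 4) : Fin 4 := ![j + 1, j - 1, j + 1, j - 1] i

/-- The neighbour of a vertex `i` in another fibre that opens the block of this fibre in the
rotation at `i`. -/
def entry : Fin 4 → Fin 4 := ![0, 3, 0, 3]

/-- The vertex of the same fibre that is opposite to `i` on the faces through the entries at `i`. -/
def partner : Fin 4 → Fin 4 := ![1, 0, 3, 2]

/-- `octNext` on the vertices of `K₈`, the first component of which is the fibre. -/
def octLocal (x y : Bool × Fin 4) : Bool × Fin 4 :=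
  ((octNext x.2 (x.1 ^^ y.1, y.2)).1 ^^ x.1, (octNext x.2 (x.1 ^^ y.1, y.2)).2)

lemma faceStep_octLocal : ∀ x, (faceStep octLocal)^[4] x = x := by decide +kernel

lemma faceStep_quadNext : ∀ x, (faceStep quadNext)^[4] x = x := by decide +kernel

lemma octNext_ne : ∀ i x, x ≠ (false, i) → octNext i x ≠ (false, i) := by decide +kernel

lemma octNext_iterate_entry : ∀ i x, x ≠ (false, i) →
    ∃ k : Fin 7, (octNext i)^[k + 1] x = (true, entry i) := by decide +kernel

lemma quadNext_iterate_entry : ∀ i j, ∃ k : Fin 4, (quadNext i)^[k + 1] j = entry i := by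
  decide +kernel

/-- With its companion `octNext_partner_entry`: the face of `K₈` through the entry at `i` also
passes through the entry at `partner i`, two steps later. -/
lemma octNext_entry_self : ∀ i, octNext (entry i) (true, i) = (true, partner i) := by
  decide +kernel

lemma octNext_partner_entry : ∀ i,
    octNext (partner i) (true, entry i) = (true, entry (partner i)) := by
  decide +kernel

lemma quadNext_entry_self : ∀ i, quadNext (entry i) i = partner i := by decide +kernel

lemma quadNext_partner_entry : ∀ i, quadNext (partner i) (entry i) = entry (partner i) := by
  decide +kernel

lemma partner_partner : ∀ i, partner (partner i) = i := by decide

/-- No face has entries at two consecutive corners. -/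
lemma partner_ne_entry_entry : ∀ i, partner i ≠ entry (entry i) := by decide

end Tables

/-! ### The blocks of the composition -/

section Block

variable {V : Type*} {μ : V → V}

/-- The copy of the vertices of `K₈` on the fibres over `v` and `μ v`. -/
def place (μ : V → V) (v : V) (x : Bool × Fin 4) : V × Fin 4 := (if x.1 then μ v else v, x.2)

open Classical in
/-- The local rotations of the blocks: `K₈` on the fibres over `v` and `μ v`, and `K₄,₄` between
any two other fibres. -/
noncomputable def blockNext (μ : V → V) (p q : V × Fin 4) : V × Fin 4 :=
  if q.1 = p.1 then place μ p.1 (octNext p.2 (false, q.2))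
  else if q.1 = μ p.1 then place μ p.1 (octNext p.2 (true, q.2))
  else (q.1, quadNext p.2 q.2)

lemma place_not (hμ : Function.Involutive μ) (v : V) (b : Bool) (i : Fin 4) :
    place μ (μ v) (b, i) = place μ v (!b, i) := by
  cases b <;> simp [place, hμ v]

lemma blockNext_place_false (hfix : ∀ v, μ v ≠ v) (v : V) (i : Fin 4) (y : Bool × Fin 4) :
    blockNext μ (v, i) (place μ v y) = place μ v (octNext i y) := by
  obtain ⟨_ | _, j⟩ := y <;> simp [blockNext, place, hfix]

lemma blockNext_place (hμ : Function.Involutive μ) (hfix : ∀ v, μ v ≠ v) (v : V)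
    (x y : Bool × Fin 4) :
    blockNext μ (place μ v x) (place μ v y) = place μ v (octLocal x y) := by
  obtain ⟨_ | _, i⟩ := x
  · change blockNext μ (v, i) _ = _
    rw [blockNext_place_false hfix]
    simp [octLocal]
  · obtain ⟨b, j⟩ := y
    have h : place μ v (b, j) = place μ (μ v) (!b, j) := by rw [place_not hμ, Bool.not_not]
    change blockNext μ (μ v, i) _ = _
    rw [h, blockNext_place_false hfix, ← Prod.mk.eta (p := octNext i (!b, j)), place_not hμ]
    simp [octLocal]

lemma blockNext_of_ne {v w : V} (h : w ≠ v) (h' : w ≠ μ v) (i j : Fin 4) :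
    blockNext μ (v, i) (w, j) = (w, quadNext i j) := by
  simp [blockNext, h, h']

/-- All faces of the blocks are quadrangles. -/
lemma faceStep_blockNext (hμ : Function.Involutive μ) (hfix : ∀ v, μ v ≠ v)
    (x : (V × Fin 4) × (V × Fin 4)) : (faceStep (blockNext μ))^[4] x = x := by
  obtain ⟨⟨v, i⟩, w, j⟩ := x
  by_cases h : w = v ∨ w = μ v
  · have hw : ∃ b, (w, j) = place μ v (b, j) := by
      obtain rfl | rfl := h
      · exact ⟨false, rfl⟩
      · exact ⟨true, rfl⟩
    obtain ⟨b, hb⟩ := hw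
    have hsemi : Function.Semiconj (Prod.map (place μ v) (place μ v)) (faceStep octLocal)
        (faceStep (blockNext μ)) := fun x =>
      Prod.ext rfl (blockNext_place hμ hfix v x.2 x.1).symm
    have := hsemi.iterate_right 4 ((false, i), (b, j))
    rw [faceStep_octLocal] at this
    rw [hb]
    exact this.symm
  · push Not at h
    have h' : v ≠ μ w := fun e => h.2 (by rw [e, hμ])
    have := faceStep_quadNext (i, j)
    simp only [Function.iterate_succ, Function.iterate_zero, Function.comp_apply, id, faceStep,
      blockNext_of_ne h.1 h.2, blockNext_of_ne h.1.symm h', Prod.mk.injEq] at this ⊢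
    have h₂ := this.2
    rw [this.1] at h₂
    simp [this.1, h₂]

open Classical in
/-- The fibre whose block contains the neighbour `q` of a vertex over `v`: for a `q` over `v`
itself, this is the fibre over `μ v`. -/
noncomputable def blockOf (μ : V → V) (v : V) (q : V × Fin 4) : V := if q.1 = v then μ v else q.1

lemma blockOf_place (v : V) (x : Bool × Fin 4) : blockOf μ v (place μ v x) = μ v := by
  obtain ⟨_ | _, j⟩ := x
  · exact if_pos rfl
  · exact ite_self _

lemma blockOf_of_ne {v : V} {q : V × Fin 4} (h : q.1 ≠ v) : blockOf μ v q = q.1 := by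
  simp [blockOf, h]

/-- The rotation of a block visits its entry. -/
lemma blockNext_iterate_entry (hfix : ∀ v, μ v ≠ v) {p q : V × Fin 4} (h : p ≠ q) :
    ∃ k, (blockNext μ p)^[k + 1] q = (blockOf μ p.1 q, entry p.2) := by
  obtain ⟨v, i⟩ := p
  obtain ⟨w, j⟩ := q
  by_cases hw : w = v ∨ w = μ v
  · have hw : ∃ b, (w, j) = place μ v (b, j) := by
      obtain rfl | rfl := hw
      · exact ⟨false, rfl⟩
      · exact ⟨true, rfl⟩
    obtain ⟨b, hb⟩ := hw
    have hne : (b, j) ≠ (false, i) := by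
      intro e
      rw [hb, e] at h
      exact h rfl
    have hsemi : Function.Semiconj (place μ v) (octNext i) (blockNext μ (v, i)) := fun x =>
      (blockNext_place_false hfix v i x).symm
    obtain ⟨k, hk⟩ := octNext_iterate_entry i _ hne
    refine ⟨k, ?_⟩
    rw [hb, blockOf_place, ← hsemi.iterate_right, hk]
    rfl
  · push Not at hw
    have hsemi : Function.Semiconj (Prod.mk w) (quadNext i) (blockNext μ (v, i)) := fun x =>
      (blockNext_of_ne hw.1 hw.2 i x).symm
    obtain ⟨k, hk⟩ := quadNext_iterate_entry i j
    refine ⟨k, ?_⟩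
    rw [blockOf_of_ne hw.1, ← hsemi.iterate_right, hk]

lemma blockOf_blockNext (p q : V × Fin 4) :
    blockOf μ p.1 (blockNext μ p q) = blockOf μ p.1 q := by
  unfold blockNext
  split_ifs with h h'
  · rw [blockOf_place, blockOf, if_pos h]
  · rw [blockOf_place, blockOf_of_ne h, h']
  · exact (blockOf_of_ne (q := (q.1, _)) h).trans (blockOf_of_ne h).symm

lemma blockOf_iterate_blockNext (p q : V × Fin 4) (n : ℕ) :
    blockOf μ p.1 ((blockNext μ p)^[n] q) = blockOf μ p.1 q := by
  induction n with
  | zero => rfl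
  | succ n ih => rw [Function.iterate_succ_apply', blockOf_blockNext, ih]

lemma blockNext_entry_self (hfix : ∀ v, μ v ≠ v) {v w : V}
    (h : v ≠ w) (i : Fin 4) : blockNext μ (w, entry i) (v, i) = (v, partner i) := by
  by_cases h' : v = μ w
  · subst h'
    have := blockNext_place_false hfix w (entry i) (true, i)
    rwa [octNext_entry_self] at this
  · rw [blockNext_of_ne h h', quadNext_entry_self]

lemma blockNext_partner_entry (hfix : ∀ v, μ v ≠ v) {v w : V}
    (h : v ≠ w) (i : Fin 4) :
    blockNext μ (v, partner i) (w, entry i) = (w, entry (partner i)) := by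
  by_cases h' : w = μ v
  · subst h'
    have := blockNext_place_false hfix v (partner i) (true, entry i)
    rwa [octNext_partner_entry] at this
  · rw [blockNext_of_ne h.symm h', quadNext_partner_entry]

lemma adj_blockNext {G : SimpleGraph V} (hadj : ∀ v, G.Adj v (μ v))
    {p q : V × Fin 4} (h : (G.composition (completeGraph (Fin 4))).Adj p q) :
    (G.composition (completeGraph (Fin 4))).Adj p (blockNext μ p q) := by
  obtain ⟨v, i⟩ := p
  obtain ⟨w, j⟩ := q
  have key : ∀ y, y ≠ (false, i) →
      (G.composition (completeGraph (Fin 4))).Adj (v, i) (place μ v y) := by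
    rintro ⟨_ | _, j⟩ hy
    · exact Or.inr ⟨rfl, fun e => hy (congrArg (Prod.mk false) e.symm)⟩
    · exact Or.inl (hadj v)
  unfold blockNext
  dsimp only
  split_ifs with h₁ h₂
  · subst h₁
    refine key _ (octNext_ne _ _ ?_)
    rintro ⟨⟩
    exact (G.composition _).irrefl h
  · exact key _ (octNext_ne _ _ (by simp))
  · exact Or.inl (h.resolve_right fun e => h₁ e.1.symm)

end Block

/-! ### Splicing the blocks -/

section Splicing

variable {V : Type*} {G : SimpleGraph V} {c : V → Equiv.Perm V} {μ : V → V}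

/-- The cyclic order of the blocks at the `i`-th vertex of a fibre: it is reversed for odd `i`. -/
def turn (c : Equiv.Perm V) (i : Fin 4) : Equiv.Perm V := ![c, c⁻¹, c, c⁻¹] i

lemma turn_partner (c : Equiv.Perm V) (i : Fin 4) (w : V) :
    turn c i (turn c (partner i) w) = w := by
  fin_cases i <;> simp [turn, partner]

lemma isCycleOn_turn {c : Equiv.Perm V} {s : Set V} (h : c.IsCycleOn s) (i : Fin 4) :
    (turn c i).IsCycleOn s := by
  fin_cases i
  exacts [h, h.inv, h, h.inv]

lemma turn_apply_eq_self {c : Equiv.Perm V} {w : V} (h : c w = w) (i : Fin 4) :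
    turn c i w = w := by
  have h' : c⁻¹ w = w := Equiv.Perm.inv_eq_iff_eq.2 h.symm
  fin_cases i
  exacts [h, h', h, h']

/-- The entry of a block is moved to the entry of the next block; everything else is fixed. -/
def spliceNext (c : V → Equiv.Perm V) (p q : V × Fin 4) : V × Fin 4 :=
  if q.2 = entry p.2 then (turn (c p.1) p.2 q.1, q.2) else q

lemma spliceNext_injective (p : V × Fin 4) : Function.Injective (spliceNext c p) := by
  rintro ⟨w, j⟩ ⟨w', j'⟩ h
  unfold spliceNext at h
  split_ifs at h <;> simp_all

lemma spliceNext_entry (v w : V) (i : Fin 4) :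
    spliceNext c (v, i) (w, entry i) = (turn (c v) i w, entry i) := by
  simp [spliceNext]

/-- The darts that lead to the entry of a block. -/
def entryDarts (G : SimpleGraph V) : Set ((V × Fin 4) × (V × Fin 4)) :=
  {x | G.Adj x.1.1 x.2.1 ∧ x.2.2 = entry x.1.2}

lemma spliceNext_of_notMem (hc' : ∀ v w, ¬ G.Adj v w → c v w = w) {p q : V × Fin 4}
    (h : (p, q) ∉ entryDarts G) : spliceNext c p q = q := by
  unfold spliceNext
  split_ifs with h'
  · rw [turn_apply_eq_self (hc' _ _ fun e => h ⟨e, h'⟩)]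
  · rfl

lemma adj_turn (hc : ∀ v, (c v).IsCycleOn (G.neighborSet v)) {v w : V} (h : G.Adj v w)
    (i : Fin 4) : G.Adj v (turn (c v) i w) :=
  (isCycleOn_turn (hc v) i).1.mapsTo h

lemma adj_spliceNext (hc : ∀ v, (c v).IsCycleOn (G.neighborSet v))
    (hc' : ∀ v w, ¬ G.Adj v w → c v w = w) {p q : V × Fin 4}
    (h : (G.composition (completeGraph (Fin 4))).Adj p q) :
    (G.composition (completeGraph (Fin 4))).Adj p (spliceNext c p q) := by
  by_cases hx : (p, q) ∈ entryDarts G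
  · rw [spliceNext, if_pos hx.2]
    exact Or.inl (adj_turn hc hx.1 _)
  · rwa [spliceNext_of_notMem hc' hx]

/-- The spliced local rotations still have only quadrangular faces. -/
lemma faceStep_splice (hμ : Function.Involutive μ) (hfix : ∀ v, μ v ≠ v)
    (hc : ∀ v, (c v).IsCycleOn (G.neighborSet v))
    (hc' : ∀ v w, ¬ G.Adj v w → c v w = w) (x : (V × Fin 4) × (V × Fin 4)) :
    (faceStep fun p => spliceNext c p ∘ blockNext μ p)^[4] x = x := by
  let γ : (V × Fin 4) × (V × Fin 4) → (V × Fin 4) × (V × Fin 4) :=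
    fun x => (x.1, spliceNext c x.1 x.2)
  have hstep : ∀ {v w : V} (i : Fin 4), G.Adj v w →
      faceStep (blockNext μ) ((v, i), (w, entry i)) = ((w, entry i), (v, partner i)) :=
    fun i h => Prod.ext rfl (blockNext_entry_self hfix h.ne i)
  have hopp : ∀ {v w : V} (i : Fin 4), G.Adj v w →
      faceStep (blockNext μ) (faceStep (blockNext μ) ((v, i), (w, entry i))) =
        ((v, partner i), (w, entry (partner i))) := fun i h => by
    rw [hstep i h]
    exact Prod.ext rfl (blockNext_partner_entry hfix h.ne i)
  have hγ : ∀ (v w : V) (i : Fin 4),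
      γ ((v, i), (w, entry i)) = ((v, i), (turn (c v) i w, entry i)) :=
    fun v w i => Prod.ext rfl (spliceNext_entry v w i)
  refine iterate_four_comp (φ := faceStep (blockNext μ)) (γ := γ) (S := entryDarts G)
    (faceStep_blockNext hμ hfix) ?_ ?_ ?_ ?_ ?_ ?_ x
  · rintro ⟨p, q⟩ ⟨p', q'⟩ h
    obtain ⟨rfl, h⟩ := Prod.ext_iff.1 h
    exact Prod.ext rfl (spliceNext_injective _ h)
  · rintro ⟨p, q⟩ h
    exact Prod.ext rfl (spliceNext_of_notMem hc' h)
  · rintro ⟨⟨v, i⟩, w, j⟩ ⟨h, rfl : j = entry i⟩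
    rw [hγ]
    exact ⟨adj_turn hc h i, rfl⟩
  · rintro ⟨⟨v, i⟩, w, j⟩ ⟨h, rfl : j = entry i⟩ h'
    rw [hstep i h] at h'
    exact partner_ne_entry_entry i h'.2
  · rintro ⟨⟨v, i⟩, w, j⟩ ⟨h, rfl : j = entry i⟩
    rw [hopp i h]
    exact ⟨h, rfl⟩
  · rintro ⟨⟨v, i⟩, w, j⟩ ⟨h, rfl : j = entry i⟩
    rw [hopp i h, hγ, hopp (partner i) (adj_turn hc h _), hγ, partner_partner, turn_partner]

/-- The spliced rotation at `p` is a single cycle: from any neighbour it leads to the entry of the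
next block, hence to the entries of all blocks. -/
lemma iterate_splice_eq_entry [Finite V] (hfix : ∀ v, μ v ≠ v) (hadj : ∀ v, G.Adj v (μ v))
    (hc : ∀ v, (c v).IsCycleOn (G.neighborSet v))
    (hc' : ∀ v w, ¬ G.Adj v w → c v w = w) {p q : V × Fin 4}
    (h : (G.composition (completeGraph (Fin 4))).Adj p q) :
    ∃ k, (spliceNext c p ∘ blockNext μ p)^[k] q = (μ p.1, entry p.2) := by
  obtain ⟨v, i⟩ := p
  have hblock : ∀ q, (G.composition (completeGraph (Fin 4))).Adj (v, i) q →
      G.Adj v (blockOf μ v q) := by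
    rintro q (h | ⟨h, -⟩)
    · rw [blockOf_of_ne h.ne']
      exact h
    · rw [blockOf, if_pos h.symm]
      exact hadj v
  have hnext : ∀ q, (G.composition (completeGraph (Fin 4))).Adj (v, i) q →
      ∃ k, (spliceNext c (v, i) ∘ blockNext μ (v, i))^[k] q =
        (turn (c v) i (blockOf μ v q), entry i) := by
    intro q h
    obtain ⟨k, hk⟩ := blockNext_iterate_entry hfix h.ne
    obtain ⟨n, hn, hn'⟩ := exists_iterate_comp_eq (γ := spliceNext c (v, i))
      (S := {q | ((v, i), q) ∈ entryDarts G}) (fun q => spliceNext_of_notMem hc') k q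
      (by rw [hk]; exact ⟨hblock q h, rfl⟩)
    refine ⟨n + 1, ?_⟩
    have e := blockOf_iterate_blockNext (μ := μ) (v, i) q (n + 1)
    rw [blockOf_of_ne hn.1.ne'] at e
    rw [hn', ← spliceNext_entry, ← e]
    exact congrArg _ (Prod.ext rfl hn.2)
  have hpow : ∀ (n : ℕ) (w : V), G.Adj v w →
      ∃ k, (spliceNext c (v, i) ∘ blockNext μ (v, i))^[k] (w, entry i) =
        ((turn (c v) i ^ n) w, entry i) := by
    intro n
    induction n with
    | zero => exact fun w _ => ⟨0, rfl⟩
    | succ n ih =>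
      intro w hw
      obtain ⟨k, hk⟩ := hnext (w, entry i) (Or.inl hw)
      rw [blockOf_of_ne hw.ne'] at hk
      obtain ⟨k', hk'⟩ := ih _ (adj_turn hc hw i)
      exact ⟨k' + k, by rw [Function.iterate_add_apply, hk, hk', pow_succ]; rfl⟩
  obtain ⟨k, hk⟩ := hnext q h
  have hw := adj_turn hc (hblock q h) i
  obtain ⟨n, hn⟩ := (isCycleOn_turn (hc v) i).exists_pow_eq' (Set.toFinite _) hw (hadj v)
  obtain ⟨k', hk'⟩ := hpow n _ hw
  exact ⟨k' + k, by rw [Function.iterate_add_apply, hk, hk', hn]⟩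

end Splicing

end SimpleGraph

theorem theorem3p1 {V : Type*} [Finite V] (G : SimpleGraph V) (hconn : G.Connected)
    (hmatch : ∃ M : G.Subgraph, M.IsPerfectMatching) :
    (G.composition (SimpleGraph.completeGraph (Fin 4))).HasOrientableQuadrangularEmbedding := by
  obtain ⟨M, hM⟩ := hmatch
  rw [SimpleGraph.Subgraph.isPerfectMatching_iff] at hM
  choose μ hMμ huniq using hM
  have hadj : ∀ v, G.Adj v (μ v) := fun v => (hMμ v).adj_sub
  have hfix : ∀ v, μ v ≠ v := fun v => (hadj v).ne'
  have hμ : Function.Involutive μ := fun v => (huniq _ _ (hMμ v).symm).symm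
  have hcyc : ∀ v, ∃ f : Equiv.Perm V, f.IsCycleOn (G.neighborSet v) ∧
      ∀ w, ¬ G.Adj v w → f w = w := by
    intro v
    classical
    have := Fintype.ofFinite V
    obtain ⟨f, hf, hsupp⟩ := (G.neighborFinset v).exists_cycleOn
    rw [SimpleGraph.coe_neighborFinset] at hf
    refine ⟨f, hf, fun w hw => ?_⟩
    by_contra h
    exact hw ((G.mem_neighborFinset v w).1 (hsupp (Equiv.Perm.mem_support.2 h)))
  choose c hc hc' using hcyc
  refine SimpleGraph.hasOrientableQuadrangularEmbedding_of_local
    (ν := fun p => SimpleGraph.spliceNext c p ∘ SimpleGraph.blockNext μ p)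
    (fun p q h => SimpleGraph.adj_spliceNext hc hc' (SimpleGraph.adj_blockNext hadj h))
    (SimpleGraph.faceStep_splice hμ hfix hc hc')
    (fun p => ⟨_, fun q => SimpleGraph.iterate_splice_eq_entry hfix hadj hc hc'⟩)
    (fun p => ⟨(μ p.1, 0), Or.inl (hadj _)⟩) (fun p q _ => ?_)
  obtain h | h := eq_or_ne q (μ p.1, 0)
  · exact ⟨(μ p.1, 1), Or.inl (hadj _), by simp [h]⟩
  · exact ⟨(μ p.1, 0), Or.inl (hadj _), h.symm⟩
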